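/- A continuum is a nonempty compact connected metric space, and a subcontinuum of $X$ is a subset of $X$ that is a continuum. For a continuum $X$ let $2^X$ be the hyperspace of nonempty closed subsets of $X$ with the Hausdorff metric (equivalently, the Vietoris topology), and let $\mathcal{F}_1(X)=\{\{x\}:x\in X\}\subseteq 2^X$. Let $\mathcal{NB}(\mathcal{F}_1(X))$ be the subspace of $2^X$ of all $A\in 2^X$ with $A\neq X$ such that, for every $x\in X\setminus A$, the union of all subcontinua of $X$ that contain $x$ and lie in $X\setminus A$ is dense in $X$. A continuum is decomposable if it is the union of two of its proper subcontinua. $X$ has the property of Kelley if, whenever $x_n\to x$ in $X$ and $A$ is a subcontinuum of $X$ with $x\in A$, there are subcontinua $A_n$ of $X$ with $x_n\in A_n$ for all $n$ and $A_n\to A$ in $2^X$. A decomposition (partition into nonempty sets) $\mathcal{D}$ of $X$ is continuous if it is upper semicontinuous (for each $D\in\mathcal{D}$ and open $U\supseteq D$ there is an open $V\supseteq D$ such that every $A\in\mathcal{D}$ that meets $V$ is contained in $U$) and lower semicontinuous (for each $D\in\mathcal{D}$, $x,y\in D$ and open $U\ni x$ there is an open $V\ni y$ such that every $A\in\mathcal{D}$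 that meets $V$ also meets $U$). **Theorem.** Let $X$ be a decomposable continuum with the property of Kelley such that $\mathcal{NB}(\mathcal{F}_1(X))$ is a continuum. For $x\in X$ let $\pi(x)$ be the intersection of all $A\in\mathcal{NB}(\mathcal{F}_1(X))$ with $x\in A$ (and $\pi(x)=X$ if there is no such $A$), let $\mathcal{N}=\{\pi(x):x\in X\}$ with the subspace topology of $2^X$, and let $q\colon X\to\mathcal{N}$, $q(x)=\pi(x)$. Then: 1. $\mathcal{N}$ is a continuous decomposition of $X$, $\mathcal{N}$ is a continuum, and $q$ is a quotient map (so the topology of $\mathcal{N}$ is the decomposition topology); 2. $\mathcal{NB}(\mathcal{F}_1(X))$ is homeomorphic to $\mathcal{NB}(\mathcal{F}_1(\mathcal{N}))$; 3. $\mathcal{F}_1(\mathcal{N})\subseteq\mathcal{NB}(\mathcal{F}_1(\mathcal{N}))$, i.e. every singleton of $\mathcal{N}$ is a nonblocker of $\mathcal{N}$. -/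

import Mathlib

open Set Filter Topology TopologicalSpace

namespace Nonblock

/-- A set is a continuum (with the subspace topology) when it is compact, connected and nonempty.
It is only applied in metrizable spaces, so metrizability of the subspace is automatic. -/
def IsContinuum {Y : Type*} [TopologicalSpace Y] (S : Set Y) : Prop :=
  IsCompact S ∧ IsConnected S

/-- `C(X)`, the subcontinua of `X`, as a subset of the hyperspace `2^X`. The hyperspace `2^X` of
nonempty closed subsets of a compact Hausdorff space `X` is `NonemptyCompacts X`, whose topology
is the Vietoris topology (for metric `X`, the topology of the Hausdorff metric). -/
def subcontinua (X : Type*) [TopologicalSpace X] : Set (NonemptyCompacts X) :=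
  {A | IsContinuum (A : Set X)}

/-- `F₁(X)`, the one-point subsets of `X`. -/
def singletons (X : Type*) [TopologicalSpace X] : Set (NonemptyCompacts X) :=
  range fun x : X => ({x} : NonemptyCompacts X)

/-- `X` is the union of two proper subcontinua. -/
def IsDecomposable (X : Type*) [TopologicalSpace X] : Prop :=
  ∃ A ∈ subcontinua X, ∃ B ∈ subcontinua X,
    (A : Set X) ≠ univ ∧ (B : Set X) ≠ univ ∧ (A : Set X) ∪ (B : Set X) = univ

/-- The property of Kelley. -/
def HasPropertyOfKelley (X : Type*) [TopologicalSpace X] : Prop :=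
  ∀ (u : ℕ → X) (x : X), Tendsto u atTop (𝓝 x) →
    ∀ A ∈ subcontinua X, x ∈ A →
      ∃ K : ℕ → NonemptyCompacts X,
        (∀ n, K n ∈ subcontinua X) ∧ (∀ n, u n ∈ K n) ∧ Tendsto K atTop (𝓝 A)

/-- `κ_{X∖A}(B)`: the union of all subcontinua of `X` that meet `B` and lie in `X ∖ A`. -/
def kappa {X : Type*} [TopologicalSpace X] (A B : Set X) : Set X :=
  {y | ∃ L ∈ subcontinua X, (B ∩ (L : Set X)).Nonempty ∧ (L : Set X) ⊆ Aᶜ ∧ y ∈ L}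

/-- `A` does not block `B` (used for disjoint `A`, `B`). -/
def DoesNotBlock {X : Type*} [TopologicalSpace X] (A B : Set X) : Prop :=
  Dense (kappa A B)

/-- `NB(F₁(X))`, the hyperspace of nonblockers. Only proper subsets of `X` are admitted: the whole
space, for which the blocking condition is vacuous, is not a nonblocker. -/
def nonblockers (X : Type*) [TopologicalSpace X] : Set (NonemptyCompacts X) :=
  {A | (A : Set X) ≠ univ ∧ ∀ x : X, x ∉ A → DoesNotBlock (A : Set X) {x}}

/-- `π(x)`: the intersection of all nonblockers containing `x`, which is the whole space `X` when
no nonblocker contains `x`. -/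
def minimalNonblocker {X : Type*} [TopologicalSpace X] [CompactSpace X] [T2Space X] (x : X) :
    NonemptyCompacts X where
  carrier := ⋂ A ∈ {A ∈ nonblockers X | x ∈ A}, (A : Set X)
  isCompact' :=
    (isClosed_biInter fun (A : NonemptyCompacts X) _ => A.isCompact.isClosed).isCompact
  nonempty' := ⟨x, mem_iInter₂.2 fun _ hA => hA.2⟩

/-- `𝒩 = {π(x) : x ∈ X}`, topologized as a subspace of `2^X`. -/
def piDecomposition (X : Type*) [TopologicalSpace X] [CompactSpace X] [T2Space X] :
    Set (NonemptyCompacts X) :=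
  range (minimalNonblocker (X := X))

/-- `q : X → 𝒩`, `q(x) = π(x)`. -/
def quotientMap (X : Type*) [TopologicalSpace X] [CompactSpace X] [T2Space X] (x : X) :
    piDecomposition X :=
  ⟨minimalNonblocker x, mem_range_self x⟩

/-- Upper semicontinuity of a family of subsets of `X`. -/
def UpperSemicontinuousFamily {X : Type*} [TopologicalSpace X] (𝒟 : Set (Set X)) : Prop :=
  ∀ D ∈ 𝒟, ∀ U : Set X, IsOpen U → D ⊆ U →
    ∃ V : Set X, IsOpen V ∧ D ⊆ V ∧ ∀ A ∈ 𝒟, (A ∩ V).Nonempty → A ⊆ U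

/-- Lower semicontinuity of a family of subsets of `X`. -/
def LowerSemicontinuousFamily {X : Type*} [TopologicalSpace X] (𝒟 : Set (Set X)) : Prop :=
  ∀ D ∈ 𝒟, ∀ x ∈ D, ∀ y ∈ D, ∀ U : Set X, IsOpen U → x ∈ U →
    ∃ V : Set X, IsOpen V ∧ y ∈ V ∧ ∀ A ∈ 𝒟, (A ∩ V).Nonempty → (A ∩ U).Nonempty

/-- A continuous decomposition of `X`: a partition of `X` into nonempty sets that is both upper
and lower semicontinuous. -/
def IsContinuousDecomposition {X : Type*} [TopologicalSpace X] (𝒟 : Set (Set X)) : Prop :=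
  Setoid.IsPartition 𝒟 ∧ UpperSemicontinuousFamily 𝒟 ∧ LowerSemicontinuousFamily 𝒟

end Nonblock

/-!
The proof rests on the *ends* of `X`: the nonblockers `C` that are terminal, in the sense that a
subcontinuum meeting `C` either lies in `C` or contains `C`. Boundary bumping shows that ends are
connected (`isContinuum_of_mem_ends`), and every nonblocker contains each end that it meets
(`end_subset_nonblocker`). Hence ends are pairwise disjoint, and `π(x)` is the end through `x`
whenever there is one. The point is to show that the ends cover `X` (`biUnion_ends_eq_univ`).

Call a continuum with nonempty interior *fat*; decomposability provides proper fat continua. By the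
property of Kelley, `κ_{X∖A}(W)` is open for a fat `W` and a closed `A` disjoint from `W`, and a
maximal proper open set of this form is the complement of an end. So every proper fat continuum
misses an end (`exists_end_subset_compl`). The property of Kelley also makes the ends a closed subset
of the compact space of nonblockers (`isClosed_ends`).

Connectedness of the space of nonblockers enters through `false_of_ends_split`: if `𝒟` is a
proper nonempty clopen set of ends, each missing a fat continuum, then the nonblockers containing a
member of `𝒟` form a proper nonempty clopen set of nonblockers. Let `Y` be the union of the ends and
let `P` be a proper fat continuum meeting `Y`. It follows that `P ∪ Y` is connected, hence a fat
continuum that misses no end, hence `P ∪ Y = X`. Were some end to meet all fat continua, then finitely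
many ends in `X∖P` would always lie in a common nonblocker (`exists_nonblocker_of_finite_ends`), and
compactness would give a nonblocker containing the open set `X∖P`, although nonblockers have empty
interior. So every end misses a fat continuum, `Y` itself is connected, and `Y` is a fat continuum
that misses no end; therefore `Y = X`.

Now `𝒩` is the closed family of ends, `π` is continuous, and `q` is an open quotient map with
connected fibres, whose preimages of continua are continua. Nonblockers of `X` are unions of ends, so
that `A ↦ q(A)` and `B ↦ q⁻¹(B)` are mutually inverse bijections between the nonblockers of `X` and
those of `𝒩`. The singletons of `𝒩` are the images of ends.
-/

namespace Nonblock

variable {X : Type*}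

/-! ### Continua -/

/-- A continuum, given as a set, as a point of the hyperspace. -/
def IsContinuum.toNonemptyCompacts [TopologicalSpace X] {S : Set X} (hS : IsContinuum S) :
    NonemptyCompacts X :=
  ⟨⟨S, hS.1⟩, hS.2.nonempty⟩

theorem mem_kappa [TopologicalSpace X] {A B : Set X} {y : X} :
    y ∈ kappa A B ↔
      ∃ L : Set X, IsContinuum L ∧ (B ∩ L).Nonempty ∧ L ⊆ Aᶜ ∧ y ∈ L :=
  ⟨fun ⟨L, hL, h⟩ => ⟨L, hL, h⟩, fun ⟨_, hL, h⟩ => ⟨hL.toNonemptyCompacts, hL, h⟩⟩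

theorem kappa_subset_compl [TopologicalSpace X] (A B : Set X) : kappa A B ⊆ Aᶜ := by
  rintro y ⟨L, -, -, hLA, hy⟩
  exact hLA hy

theorem kappa_anti_left [TopologicalSpace X] {A A' : Set X} (h : A' ⊆ A) (B : Set X) :
    kappa A B ⊆ kappa A' B := by
  rintro y ⟨L, hL, hBL, hLA, hy⟩
  exact ⟨L, hL, hBL, hLA.trans (compl_subset_compl.2 h), hy⟩

theorem subset_kappa [TopologicalSpace X] {A W : Set X} (hW : IsContinuum W) (hWA : W ⊆ Aᶜ) :
    W ⊆ kappa A W := fun y hy =>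
  mem_kappa.2 ⟨W, hW, ⟨y, hy, hy⟩, hWA, hy⟩

theorem IsContinuum.union [TopologicalSpace X] {S T : Set X} (hS : IsContinuum S)
    (hT : IsContinuum T) (h : (S ∩ T).Nonempty) : IsContinuum (S ∪ T) :=
  ⟨hS.1.union hT.1, hS.2.union h hT.2⟩

/-- Two points of `κ_{X∖A}(W)` are joined by a subcontinuum that contains `W` and misses `A`. -/
theorem kappa_join [TopologicalSpace X] {A W : Set X} (hW : IsContinuum W) (hWA : W ⊆ Aᶜ)
    {x y : X} (hx : x ∈ kappa A W) (hy : y ∈ kappa A W) : y ∈ kappa A {x} := by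
  obtain ⟨K, hK, hWK, hKA, hxK⟩ := mem_kappa.1 hx
  obtain ⟨L, hL, hWL, hLA, hyL⟩ := mem_kappa.1 hy
  refine mem_kappa.2 ⟨(W ∪ K) ∪ L, (hW.union hK hWK).union hL ?_, ⟨x, rfl, Or.inl (Or.inr hxK)⟩,
    union_subset (union_subset hWA hKA) hLA, Or.inr hyL⟩
  exact hWL.mono (inter_subset_inter_left _ subset_union_left)

/-- Boundary bumping: in a connected compact Hausdorff space, no component of a proper closed
subset lies in the interior of that subset. -/
theorem not_connectedComponentIn_subset_interior [TopologicalSpace X] [T2Space X] [CompactSpace X]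
    [PreconnectedSpace X] {F : Set X} (hF : IsClosed F) (hFu : F ≠ univ) {x : X} (hx : x ∈ F) :
    ¬ connectedComponentIn F x ⊆ interior F := by
  intro hsub
  have : CompactSpace F := isCompact_iff_compactSpace.1 hF.isCompact
  set O : Set F := (↑) ⁻¹' interior F with hO
  have hOo : IsOpen O := isOpen_interior.preimage continuous_subtype_val
  have hcO : connectedComponent (⟨x, hx⟩ : F) ⊆ O := by
    intro y hy
    apply hsub
    rw [connectedComponentIn_eq_image hx]
    exact mem_image_of_mem _ hy
  rw [connectedComponent_eq_iInter_isClopen] at hcO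
  have : Nonempty {Z : Set F // IsClopen Z ∧ (⟨x, hx⟩ : F) ∈ Z} :=
    ⟨⟨univ, isClopen_univ, trivial⟩⟩
  obtain ⟨Z, hZ⟩ := exists_subset_nhds_of_isCompact' (V := fun Z : {Z : Set F // IsClopen Z ∧
      (⟨x, hx⟩ : F) ∈ Z} => (Z : Set F)) (U := O)
    (fun Z Z' => ⟨⟨Z.1 ∩ Z'.1, Z.2.1.inter Z'.2.1, Z.2.2, Z'.2.2⟩, inter_subset_left,
      inter_subset_right⟩)
    (fun Z => Z.2.1.isClosed.isCompact) (fun Z => Z.2.1.isClosed)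
    (fun y hy => hOo.mem_nhds (hcO hy))
  obtain ⟨Z, hZc, hxZ⟩ := Z
  have hcl : IsClosed ((↑) '' Z : Set X) := hF.isClosedMap_subtype_val _ hZc.isClosed
  have hop : IsOpen ((↑) '' Z : Set X) := by
    obtain ⟨G, hG, hGZ⟩ := isOpen_induced_iff.1 hZc.isOpen
    have : ((↑) '' Z : Set X) = G ∩ interior F := by
      ext y
      constructor
      · rintro ⟨z, hz, rfl⟩
        exact ⟨by rw [← hGZ] at hz; exact hz, hZ hz⟩
      · rintro ⟨hyG, hyF⟩
        exact ⟨⟨y, interior_subset hyF⟩, by rw [← hGZ]; exact hyG, rfl⟩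
    rw [this]
    exact hG.inter isOpen_interior
  have huniv := IsClopen.eq_univ ⟨hcl, hop⟩ ⟨x, ⟨x, hx⟩, hxZ, rfl⟩
  apply hFu
  rw [eq_univ_iff_forall] at huniv ⊢
  intro y
  obtain ⟨z, -, rfl⟩ := huniv y
  exact z.2

theorem isContinuum_connectedComponentIn [TopologicalSpace X] [T2Space X] [CompactSpace X]
    {F : Set X} (hF : IsClosed F) {x : X} (hx : x ∈ F) :
    IsContinuum (connectedComponentIn F x) := by
  refine ⟨IsClosed.isCompact ?_, isConnected_connectedComponentIn_iff.2 hx⟩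
  rw [connectedComponentIn_eq_image hx]
  exact hF.isClosedMap_subtype_val _ isClosed_connectedComponent

/-! ### The property of Kelley and openness of `κ` -/

/-- The property of Kelley in terms of neighbourhoods: if a subcontinuum `K ∋ x` lies in an open
set `U` and meets an open set `O`, then so does some subcontinuum through each point near `x`. -/
theorem HasPropertyOfKelley.eventually [TopologicalSpace X] [FirstCountableTopology X]
    (h : HasPropertyOfKelley X) {K U O : Set X} {x : X} (hK : IsContinuum K) (hx : x ∈ K)
    (hU : IsOpen U) (hKU : K ⊆ U) (hO : IsOpen O) (hKO : (K ∩ O).Nonempty) :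
    ∀ᶠ y in 𝓝 x, ∃ L : Set X, IsContinuum L ∧ y ∈ L ∧ L ⊆ U ∧ (L ∩ O).Nonempty := by
  by_contra hcon
  obtain ⟨u, hu, hbad⟩ := exists_seq_forall_of_frequently (not_eventually.1 hcon)
  obtain ⟨L, hL, huL, hlim⟩ := h u x hu hK.toNonemptyCompacts hK hx
  have h1 := hlim.eventually
    ((NonemptyCompacts.isOpen_subsets_of_isOpen hU).mem_nhds hKU)
  have h2 := hlim.eventually
    ((NonemptyCompacts.isOpen_inter_nonempty_of_isOpen hO).mem_nhds hKO)
  obtain ⟨n, hn1, hn2⟩ := (h1.and h2).exists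
  exact hbad n ⟨L n, hL n, huL n, hn1, hn2⟩

/-- With the property of Kelley, `κ_{X∖A}(W)` is open when the continuum `W` has interior. -/
theorem HasPropertyOfKelley.isOpen_kappa [TopologicalSpace X] [FirstCountableTopology X]
    (h : HasPropertyOfKelley X) {A W : Set X} (hA : IsClosed A) (hW : IsContinuum W)
    (hWi : (interior W).Nonempty) (hWA : W ⊆ Aᶜ) : IsOpen (kappa A W) := by
  rw [isOpen_iff_mem_nhds]
  intro y hy
  obtain ⟨K, hK, hWK, hKA, hyK⟩ := mem_kappa.1 hy
  have hev := h.eventually (hW.union hK hWK) (Or.inr hyK) hA.isOpen_compl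
    (union_subset hWA hKA) isOpen_interior
    (hWi.mono fun z hz => ⟨Or.inl (interior_subset hz), hz⟩)
  filter_upwards [hev] with z ⟨L, hL, hzL, hLA, w, hwL, hwW⟩
  exact mem_kappa.2 ⟨L, hL, ⟨w, interior_subset hwW, hwL⟩, hLA, hzL⟩

/-! ### Nonblockers and ends -/

theorem compl_nonempty_of_mem_nonblockers [TopologicalSpace X] {A : NonemptyCompacts X}
    (hA : A ∈ nonblockers X) : ((A : Set X)ᶜ).Nonempty :=
  nonempty_compl.2 hA.1

/-- A nonblocker has dense complement. -/
theorem dense_compl_of_mem_nonblockers [TopologicalSpace X] {A : NonemptyCompacts X}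
    (hA : A ∈ nonblockers X) : Dense ((A : Set X)ᶜ) := by
  obtain ⟨x, hx⟩ := compl_nonempty_of_mem_nonblockers hA
  exact Dense.mono (kappa_subset_compl _ _) (hA.2 x hx)

theorem not_subset_of_mem_nonblockers [TopologicalSpace X] {A : NonemptyCompacts X}
    (hA : A ∈ nonblockers X) {O : Set X} (hO : (interior O).Nonempty) : ¬ O ⊆ A := by
  intro h
  obtain ⟨x, hxO, hxA⟩ := (dense_compl_of_mem_nonblockers hA).inter_open_nonempty _
    isOpen_interior hO
  exact hxA (h (interior_subset hxO))

/-- From a point outside a nonblocker, every nonempty open set is reached by a subcontinuum that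
misses the nonblocker. -/
theorem exists_continuum_of_mem_nonblockers [TopologicalSpace X] {A : NonemptyCompacts X}
    (hA : A ∈ nonblockers X) {x : X} (hx : x ∉ A) {O : Set X} (hO : IsOpen O)
    (hOne : O.Nonempty) :
    ∃ L : Set X, IsContinuum L ∧ x ∈ L ∧ L ⊆ (A : Set X)ᶜ ∧ (L ∩ O).Nonempty := by
  obtain ⟨y, hyO, hy⟩ := Dense.inter_open_nonempty (hA.2 x hx) O hO hOne
  obtain ⟨L, hL, ⟨z, rfl, hzL⟩, hLA, hyL⟩ := mem_kappa.1 hy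
  exact ⟨L, hL, hzL, hLA, y, hyL, hyO⟩

/-- If a nonblocker `A` misses a continuum `W` with interior, then `W` is joined to every point of
`X∖A` by a continuum missing `A`. -/
theorem compl_subset_kappa_of_mem_nonblockers [TopologicalSpace X] {A : NonemptyCompacts X}
    (hA : A ∈ nonblockers X) {W : Set X} (hWi : (interior W).Nonempty) :
    (A : Set X)ᶜ ⊆ kappa (A : Set X) W := by
  intro x hx
  obtain ⟨L, hL, hxL, hLA, w, hwL, hwW⟩ :=
    exists_continuum_of_mem_nonblockers hA hx isOpen_interior hWi
  exact mem_kappa.2 ⟨L, hL, ⟨w, interior_subset hwW, hwL⟩, hLA, hxL⟩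

/-- The ends of `X`: the nonblockers that are terminal, in the sense that any subcontinuum meeting
them either is contained in them or contains them. -/
def ends (X : Type*) [TopologicalSpace X] : Set (NonemptyCompacts X) :=
  {C | C ∈ nonblockers X ∧ ∀ K : Set X, IsContinuum K → (K ∩ C).Nonempty →
    K ⊆ C ∨ (C : Set X) ⊆ K}

/-- A nonblocker contains every end that it meets. -/
theorem end_subset_nonblocker [TopologicalSpace X] [T2Space X] {C A : NonemptyCompacts X}
    (hC : C ∈ ends X) (hA : A ∈ nonblockers X) (h : ((C : Set X) ∩ A).Nonempty) :
    (C : Set X) ⊆ A := by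
  intro c hc
  by_contra hcA
  obtain ⟨L, hL, hcL, hLA, y, hyL, hyC⟩ := exists_continuum_of_mem_nonblockers hA hcA
    C.isCompact.isClosed.isOpen_compl (compl_nonempty_of_mem_nonblockers hC.1)
  obtain hLC | hCL := hC.2 L hL ⟨c, hcL, hc⟩
  · exact hyC (hLC hyL)
  · obtain ⟨z, hzC, hzA⟩ := h
    exact hLA (hCL hzC) hzA

theorem ends_eq_of_inter_nonempty [TopologicalSpace X] [T2Space X] {C D : NonemptyCompacts X}
    (hC : C ∈ ends X) (hD : D ∈ ends X) (h : ((C : Set X) ∩ D).Nonempty) : C = D :=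
  NonemptyCompacts.ext ((end_subset_nonblocker hC hD.1 h).antisymm
    (end_subset_nonblocker hD hC.1 (by rwa [inter_comm])))

/-- Ends are connected: otherwise boundary bumping gives a continuum which leaves the end but meets
only one part of it. -/
theorem isContinuum_of_mem_ends [TopologicalSpace X] [T2Space X] [CompactSpace X]
    [PreconnectedSpace X] {C : NonemptyCompacts X} (hC : C ∈ ends X) :
    IsContinuum (C : Set X) := by
  refine ⟨C.isCompact, C.nonempty, ?_⟩
  rw [isPreconnected_iff_subset_of_fully_disjoint_closed C.isCompact.isClosed]
  intro u v hu hv hCuv huv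
  by_contra! hcon
  obtain ⟨⟨y, hyC, hyu⟩, z, hzC, hzv⟩ := hcon.imp not_subset.1 not_subset.1
  have hyv := (hCuv hyC).resolve_left hyu
  have hzu := (hCuv hzC).resolve_right hzv
  obtain ⟨G, hG, huG, hGv⟩ := normal_exists_closure_subset hu hv.isOpen_compl
    (fun a hau hav => huv.le_bot ⟨hau, hav⟩)
  have hne : closure G ≠ univ := fun h => hGv (h ▸ mem_univ y) hyv
  have hzG : z ∈ closure G := subset_closure (huG hzu)
  have hK := isContinuum_connectedComponentIn isClosed_closure hzG
  have hsub := connectedComponentIn_subset (closure G) z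
  obtain hKC | hCK := hC.2 _ hK ⟨z, mem_connectedComponentIn hzG, hzC⟩
  · refine not_connectedComponentIn_subset_interior isClosed_closure hne hzG fun a ha => ?_
    exact interior_maximal subset_closure hG
      (huG ((hCuv (hKC ha)).resolve_right (hGv (hsub ha))))
  · exact hGv (hsub (hCK hyC)) hyv

/-- The ends form a closed subset of the hyperspace of nonblockers. -/
theorem isClosed_ends [TopologicalSpace X] [FirstCountableTopology X] [T2Space X] [CompactSpace X]
    (h : HasPropertyOfKelley X) (hNB : IsClosed (nonblockers X)) : IsClosed (ends X) := by
  refine isClosed_of_closure_subset fun B hB => ?_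
  have hBN : B ∈ nonblockers X := hNB.closure_subset_iff.2 (fun C hC => hC.1) hB
  refine ⟨hBN, fun K hK ⟨b, hbK, hbB⟩ => ?_⟩
  by_contra! hcon
  obtain ⟨⟨y, hyK, hyB⟩, z, hzB, hzK⟩ := hcon.imp not_subset.1 not_subset.1
  -- Approximate `B` by an end `C` and `K` by a continuum `L` through a point of `C`, so closely
  -- that neither of `C`, `L` contains the other.
  obtain ⟨U, hU, hKU, hUz⟩ := normal_exists_closure_subset hK.1.isClosed
    isClosed_singleton.isOpen_compl (show K ⊆ {z}ᶜ by rintro a ha rfl; exact hzK ha)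
  obtain ⟨O, hO, hyO, hOB⟩ := normal_exists_closure_subset isClosed_singleton
    B.isCompact.isClosed.isOpen_compl (singleton_subset_iff.2 hyB)
  obtain ⟨N, hN, hNo, hbN⟩ := eventually_nhds_iff.1 (h.eventually hK hbK hU hKU hO
    ⟨y, hyK, hyO rfl⟩)
  have hopen := ((NonemptyCompacts.isOpen_subsets_of_isOpen
      (isClosed_closure (s := O)).isOpen_compl).inter
    (NonemptyCompacts.isOpen_inter_nonempty_of_isOpen hNo)).inter
    (NonemptyCompacts.isOpen_inter_nonempty_of_isOpen (isClosed_closure (s := U)).isOpen_compl)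
  obtain ⟨C, ⟨⟨hCO, p, hpC, hpN⟩, q, hqC, hqU⟩, hC⟩ := mem_closure_iff.1 hB _ hopen
    ⟨⟨fun a ha ha' => hOB ha' ha, b, hbB, hbN⟩, z, hzB, fun hz => hUz hz rfl⟩
  obtain ⟨L, hL, hpL, hLU, r, hrL, hrO⟩ := hN p hpN
  obtain hLC | hCL := hC.2 L hL ⟨p, hpL, hpC⟩
  · exact hCO (hLC hrL) (subset_closure hrO)
  · exact hqU (subset_closure (hLU (hCL hqC)))

/-! ### Existence of ends -/

/-- `V` is a reach of `W`: a proper open set containing `W` in which every point lies in a continuum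
that meets `W` and is contained in `V`. -/
def IsReach [TopologicalSpace X] (W V : Set X) : Prop :=
  IsOpen V ∧ V ≠ univ ∧ W ⊆ V ∧ V ⊆ kappa Vᶜ W

theorem isReach_kappa [TopologicalSpace X] [FirstCountableTopology X]
    (h : HasPropertyOfKelley X) {A W : Set X} (hA : IsClosed A) (hAne : A.Nonempty)
    (hW : IsContinuum W) (hWi : (interior W).Nonempty) (hWA : W ⊆ Aᶜ) :
    IsReach W (kappa A W) := by
  refine ⟨h.isOpen_kappa hA hW hWi hWA, fun hu => ?_, subset_kappa hW hWA, fun p hp => ?_⟩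
  · obtain ⟨a, ha⟩ := hAne
    exact kappa_subset_compl A W (hu ▸ mem_univ a) ha
  · obtain ⟨L, hL, hWL, hLA, hpL⟩ := mem_kappa.1 hp
    refine mem_kappa.2 ⟨L, hL, hWL, fun q hq hqn => hqn ?_, hpL⟩
    exact mem_kappa.2 ⟨L, hL, hWL, hLA, hq⟩

/-- Any two points of a reach lie in a common continuum inside it, so that the complement of a
dense reach is a nonblocker. -/
theorem IsReach.exists_nonblocker [TopologicalSpace X] [CompactSpace X] {W V : Set X}
    (hV : IsReach W V) (hW : IsContinuum W) (hd : Dense V) :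
    ∃ A ∈ nonblockers X, (A : Set X) = Vᶜ := by
  have hWV : W ⊆ Vᶜᶜ := by simpa using hV.2.2.1
  refine ⟨⟨⟨Vᶜ, hV.1.isClosed_compl.isCompact⟩, nonempty_compl.2 hV.2.1⟩, ⟨fun hu => ?_, ?_⟩, rfl⟩
  · obtain ⟨w, hw⟩ := hW.2.nonempty
    exact (show w ∈ Vᶜ from (show Vᶜ = univ from hu) ▸ mem_univ w) (hV.2.2.1 hw)
  · intro x hx
    have hxV : x ∈ V := not_not.1 hx
    exact hd.mono fun y hy => kappa_join hW hWV (hV.2.2.2 hxV) (hV.2.2.2 hy)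

theorem IsReach.isPreconnected [TopologicalSpace X] {W V : Set X}
    (hV : IsReach W V) (hW : IsContinuum W) : IsPreconnected V := by
  obtain ⟨w, hw⟩ := hW.2.nonempty
  refine isPreconnected_of_forall w fun y hy => ?_
  obtain ⟨L, hL, hWL, hLV, hyL⟩ := mem_kappa.1 (hV.2.2.2 hy)
  rw [compl_compl] at hLV
  exact ⟨W ∪ L, union_subset hV.2.2.1 hLV, Or.inl hw, Or.inr hyL, (hW.union hL hWL).2.2⟩

/-- Every reach of a continuum with interior misses an end. The complement of a maximal reach `V` is
an end: if `V` were not dense, a reach of the proper continuum `closure V` would be larger. -/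
theorem IsReach.exists_end [TopologicalSpace X] [FirstCountableTopology X] [T2Space X]
    [CompactSpace X] [PreconnectedSpace X] (h : HasPropertyOfKelley X) {W V₀ : Set X}
    (hV₀ : IsReach W V₀) (hW : IsContinuum W) (hWi : (interior W).Nonempty) :
    ∃ C ∈ ends X, (C : Set X) ⊆ V₀ᶜ := by
  obtain ⟨V, hV₀V, hV, hmax⟩ := zorn_subset_nonempty {V | IsReach W V} (by
    rintro c hc hchain ⟨V₁, hV₁⟩
    refine ⟨⋃₀ c, ⟨isOpen_sUnion fun V hV => (hc hV).1, fun hu => ?_, ?_, ?_⟩,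
      fun s hs => subset_sUnion_of_mem hs⟩
    · have : Nonempty c := ⟨⟨V₁, hV₁⟩⟩
      obtain ⟨V, hV⟩ := isCompact_univ.elim_directed_cover (fun V : c => (V : Set X))
        (fun V => (hc V.2).1) (by rw [← sUnion_eq_iUnion, hu]) hchain.directed
      exact (hc V.2).2.1 (univ_subset_iff.1 hV)
    · exact (hc hV₁).2.2.1.trans (subset_sUnion_of_mem hV₁)
    · rintro x ⟨V, hVc, hxV⟩
      exact kappa_anti_left (compl_subset_compl.2 (subset_sUnion_of_mem hVc)) _
        ((hc hVc).2.2.2 hxV)) V₀ hV₀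
  have hWne : W.Nonempty := hW.2.nonempty
  have hdense : Dense V := by
    rw [dense_iff_closure_eq]
    by_contra hne
    obtain ⟨z, hz⟩ := (ne_univ_iff_exists_notMem _).1 hne
    have hcont : IsContinuum (closure V) := ⟨isClosed_closure.isCompact,
      (hWne.mono hV.2.2.1).mono subset_closure, (hV.isPreconnected hW).closure⟩
    have hsub : W ⊆ closure V := hV.2.2.1.trans subset_closure
    have hr := isReach_kappa h isClosed_singleton (singleton_nonempty z) hcont
      (hWi.mono (interior_mono hsub)) (by rintro a ha rfl; exact hz ha)
    have hr' : IsReach W (kappa {z} (closure V)) := by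
      refine ⟨hr.1, hr.2.1, hsub.trans hr.2.2.1, fun p hp => ?_⟩
      obtain ⟨w, hw⟩ := hWne
      have hcl : closure V ⊆ (kappa {z} (closure V))ᶜᶜ := by simpa using hr.2.2.1
      obtain ⟨L, hL, ⟨w', rfl, hwL⟩, hLV, hpL⟩ := mem_kappa.1
        (kappa_join hcont hcl (hr.2.2.2 (hr.2.2.1 (hsub hw))) (hr.2.2.2 hp))
      exact mem_kappa.2 ⟨L, hL, ⟨w', hw, hwL⟩, hLV, hpL⟩
    have hVeq : closure V ⊆ V :=
      hr.2.2.1.trans (hmax hr' (subset_closure.trans hr.2.2.1))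
    have hclopen : IsClopen V := ⟨closure_subset_iff_isClosed.1 hVeq, hV.1⟩
    exact hV.2.1 (hclopen.eq_univ (hWne.mono hV.2.2.1))
  obtain ⟨A, hA, hAV⟩ := hV.exists_nonblocker hW hdense
  -- Every continuum that meets both `W` and `Vᶜ` contains `Vᶜ`.
  have hkey : ∀ K : Set X, IsContinuum K → (W ∩ K).Nonempty → (K ∩ Vᶜ).Nonempty → Vᶜ ⊆ K := by
    rintro K hK hWK ⟨p, hpK, hpV⟩ z hzV
    by_contra hzK
    have hWz : W ⊆ {z}ᶜ := by rintro a ha rfl; exact hzV (hV.2.2.1 ha)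
    have hr := isReach_kappa h isClosed_singleton (singleton_nonempty z) hW hWi hWz
    have hle : V ⊆ kappa {z} W :=
      hV.2.2.2.trans (kappa_anti_left (singleton_subset_iff.2 hzV) W)
    exact hpV (hmax hr hle (mem_kappa.2 ⟨K, hK, hWK, by rintro a ha rfl; exact hzK ha, hpK⟩))
  refine ⟨A, ⟨hA, fun K hK hKA => ?_⟩, hAV ▸ compl_subset_compl.2 hV₀V⟩
  rw [hAV] at hKA ⊢
  by_contra! hcon
  obtain ⟨y, hyK, hyV⟩ := not_subset.1 hcon.1
  obtain ⟨L, hL, ⟨w, hwW, hwL⟩, hLV, hyL⟩ := mem_kappa.1 (hV.2.2.2 (not_not.1 hyV))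
  have hle := hkey (K ∪ L) (hK.union hL ⟨y, hyK, hyL⟩) ⟨w, hwW, Or.inr hwL⟩
    (hKA.mono (inter_subset_inter_left _ subset_union_left))
  exact hcon.2 fun a ha => (hle ha).resolve_right fun haL => hLV haL ha

/-- Every proper continuum with interior misses an end. -/
theorem exists_end_subset_compl [TopologicalSpace X] [FirstCountableTopology X] [T2Space X]
    [CompactSpace X] [PreconnectedSpace X] (h : HasPropertyOfKelley X) {W : Set X}
    (hW : IsContinuum W) (hWi : (interior W).Nonempty) (hWu : W ≠ univ) :
    ∃ C ∈ ends X, (C : Set X) ⊆ Wᶜ := by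
  obtain ⟨z, hz⟩ := (ne_univ_iff_exists_notMem _).1 hWu
  have hr := isReach_kappa h isClosed_singleton (singleton_nonempty z) hW hWi
    (by rintro a ha rfl; exact hz ha)
  obtain ⟨C, hC, hCV⟩ := hr.exists_end h hW hWi
  exact ⟨C, hC, hCV.trans (compl_subset_compl.2 hr.2.2.1)⟩

/-! ### Splitting the space of ends -/

/-- `C` misses some continuum with nonempty interior. -/
def MissesFat [TopologicalSpace X] (C : NonemptyCompacts X) : Prop :=
  ∃ W : Set X, IsContinuum W ∧ (interior W).Nonempty ∧ W ⊆ (C : Set X)ᶜ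

theorem subset_of_tendsto [TopologicalSpace X] [T2Space X] {ι : Type*} {l : Filter ι} [l.NeBot]
    {C A : ι → NonemptyCompacts X} {C₀ A₀ : NonemptyCompacts X} (hC : Tendsto C l (𝓝 C₀))
    (hA : Tendsto A l (𝓝 A₀)) (hCA : ∀ i, (C i : Set X) ⊆ A i) : (C₀ : Set X) ⊆ A₀ := by
  intro x hx
  by_contra hxA
  obtain ⟨U, V, hU, hV, hxU, hAV, hUV⟩ := SeparatedNhds.of_isCompact_isCompact
    (isCompact_singleton (x := x)) A₀.isCompact (disjoint_singleton_left.2 hxA)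
  obtain ⟨i, ⟨y, hyC, hyU⟩, hiV⟩ := ((hC.eventually
    ((NonemptyCompacts.isOpen_inter_nonempty_of_isOpen hU).mem_nhds ⟨x, hx, hxU rfl⟩)).and
    (hA.eventually ((NonemptyCompacts.isOpen_subsets_of_isOpen hV).mem_nhds hAV))).exists
  exact hUV.le_bot ⟨hyU, hiV (hCA i hyC)⟩

/-- If all members of a nonempty clopen subset `𝒟` of the space of ends miss a fat continuum, then
`𝒟` contains all ends: the nonblockers containing a member of `𝒟` form a clopen subset of the
connected space of nonblockers. -/
theorem false_of_ends_split [TopologicalSpace X] [SecondCountableTopology X] [T2Space X]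
    [CompactSpace X] [PreconnectedSpace X]
    (h : HasPropertyOfKelley X) (hNB : IsContinuum (nonblockers X))
    {𝒟 ℰ : Set (NonemptyCompacts X)} (h𝒟 : IsClosed 𝒟) (hℰ : IsClosed ℰ)
    (hunion : 𝒟 ∪ ℰ = ends X) (hdisj : Disjoint 𝒟 ℰ) (h𝒟ne : 𝒟.Nonempty) (hℰne : ℰ.Nonempty)
    (hfat : ∀ C ∈ 𝒟, MissesFat C) : False := by
  have h𝒟e : 𝒟 ⊆ ends X := hunion ▸ subset_union_left
  have hℰe : ℰ ⊆ ends X := hunion ▸ subset_union_right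
  set S : Set (NonemptyCompacts X) := {A | ∃ C ∈ 𝒟, (C : Set X) ⊆ A} with hS
  have hScl : IsClosed S := by
    refine IsSeqClosed.isClosed fun A A₀ hA hlim => ?_
    choose C hC hCA using hA
    obtain ⟨C₀, hC₀, φ, hφ, hCφ⟩ := h𝒟.isCompact.tendsto_subseq hC
    exact ⟨C₀, hC₀, subset_of_tendsto hCφ (hlim.comp hφ.tendsto_atTop) fun n => hCA (φ n)⟩
  have hTcl : IsClosed (nonblockers X \ S) := by
    refine isClosed_of_closure_subset fun A hA => ⟨hNB.1.isClosed.closure_subset_iff.2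
      sdiff_subset hA, ?_⟩
    rintro ⟨C, hC, hCA⟩
    obtain ⟨W, hW, hWi, hWC⟩ := hfat C hC
    obtain ⟨c, hc⟩ := C.nonempty
    have hcW : c ∈ Wᶜ := fun hcW => hWC hcW hc
    -- Nonblockers `A n → A` outside `S`, with points `a n ∈ A n` converging to `c ∈ C`.
    have hmem : (A, c) ∈ closure {p : NonemptyCompacts X × X |
        p.1 ∈ nonblockers X \ S ∧ p.2 ∈ p.1 ∧ p.2 ∉ W} := by
      rw [mem_closure_iff_nhds]
      intro t ht
      obtain ⟨𝒰, h𝒰, O, hO, hsub⟩ := mem_nhds_prod_iff.1 ht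
      obtain ⟨O', hO'O, hO', hcO'⟩ := mem_nhds_iff.1
        (inter_mem hO (hW.1.isClosed.isOpen_compl.mem_nhds hcW))
      obtain ⟨A', ⟨hA'𝒰, a, haA', haO'⟩, hA'⟩ := mem_closure_iff_nhds.1 hA _ (inter_mem h𝒰
        ((NonemptyCompacts.isOpen_inter_nonempty_of_isOpen hO').mem_nhds ⟨c, hCA hc, hcO'⟩))
      exact ⟨(A', a), hsub ⟨hA'𝒰, (hO'O haO').1⟩, hA', haA', (hO'O haO').2⟩
    obtain ⟨p, hp, hplim⟩ := mem_closure_iff_seq_limit.1 hmem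
    have halim : Tendsto (fun n => (p n).2) atTop (𝓝 c) :=
      (continuous_snd.tendsto (A, c)).comp hplim
    -- The set `κ_{X∖{a n}}(W)` misses an end, which cannot belong to `𝒟`.
    have hex : ∀ n, ∃ T ∈ ℰ, (T : Set X) ⊆ (kappa {(p n).2} W)ᶜ := by
      intro n
      obtain ⟨⟨hpN, hpS⟩, hpa, hpW⟩ := hp n
      have hWp : W ⊆ {(p n).2}ᶜ := fun w hw hwp => hpW (hwp ▸ hw)
      obtain ⟨T, hT, hTV⟩ := (isReach_kappa h isClosed_singleton (singleton_nonempty _) hW hWi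
        hWp).exists_end h hW hWi
      refine ⟨T, ((hunion.symm ▸ hT : T ∈ 𝒟 ∪ ℰ)).resolve_left fun hT𝒟 => ?_, hTV⟩
      obtain ⟨t, ht⟩ := T.nonempty
      have htp : t ∉ (p n).1 := fun htp =>
        hpS ⟨T, hT𝒟, end_subset_nonblocker hT hpN ⟨t, ht, htp⟩⟩
      obtain ⟨L, hL, htL, hLp, w, hwL, hwW⟩ :=
        exists_continuum_of_mem_nonblockers hpN htp isOpen_interior hWi
      exact hTV ht (mem_kappa.2 ⟨L, hL, ⟨w, interior_subset hwW, hwL⟩,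
        hLp.trans (compl_subset_compl.2 (singleton_subset_iff.2 hpa)), htL⟩)
    choose T hTℰ hTV using hex
    obtain ⟨E, hE, φ, hφ, hTφ⟩ := hℰ.isCompact.tendsto_subseq hTℰ
    have hEC : Disjoint (E : Set X) C := by
      rw [disjoint_iff_inter_eq_empty, ← not_nonempty_iff_eq_empty]
      intro hne
      exact hdisj.le_bot ⟨hC, ends_eq_of_inter_nonempty (hℰe hE) (h𝒟e hC) hne ▸ hE⟩
    -- A continuum from the limit end `E` to `W` missing `C` contradicts that every continuum
    -- from `T n` to `W` contains `a n`.
    obtain ⟨t, ht⟩ := E.nonempty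
    obtain ⟨K, hK, hWK, hKC, htK⟩ := mem_kappa.1
      (compl_subset_kappa_of_mem_nonblockers (h𝒟e hC).1 hWi
        (fun htC => hEC.le_bot ⟨ht, htC⟩ : t ∈ (C : Set X)ᶜ))
    have hKW := hW.union hK hWK
    obtain ⟨U, hU, hKU, hUC⟩ := normal_exists_closure_subset hKW.1.isClosed
      C.isCompact.isClosed.isOpen_compl (union_subset hWC hKC)
    obtain ⟨N, hN, hNo, htN⟩ := eventually_nhds_iff.1 (h.eventually hKW (Or.inr htK) hU hKU
      isOpen_interior (hWi.mono fun z hz => ⟨Or.inl (interior_subset hz), hz⟩))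
    obtain ⟨n, ⟨y, hyT, hyN⟩, hn⟩ := ((hTφ.eventually
      ((NonemptyCompacts.isOpen_inter_nonempty_of_isOpen hNo).mem_nhds ⟨t, ht, htN⟩)).and
      ((halim.comp hφ.tendsto_atTop).eventually (isClosed_closure.isOpen_compl.mem_nhds
        fun hcU => hUC hcU hc))).exists
    obtain ⟨L, hL, hyL, hLU, w, hwL, hwW⟩ := hN y hyN
    exact hTV (φ n) hyT (mem_kappa.2 ⟨L, hL, ⟨w, interior_subset hwW, hwL⟩,
      by rintro z hzL rfl; exact hn (subset_closure (hLU hzL)), hyL⟩)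
  obtain ⟨C, hC⟩ := h𝒟ne
  obtain ⟨E, hE⟩ := hℰne
  have hES : E ∉ S := by
    rintro ⟨D, hD, hDE⟩
    have := ends_eq_of_inter_nonempty (h𝒟e hD) (hℰe hE) (D.nonempty.mono fun x hx => ⟨hx, hDE hx⟩)
    exact hdisj.le_bot ⟨hD, this ▸ hE⟩
  obtain ⟨Z, -, hZS, hZ⟩ := isPreconnected_closed_iff.1 hNB.2.2 _ _ hScl hTcl
    (fun A hA => (em (A ∈ S)).imp id fun hAS => ⟨hA, hAS⟩)
    ⟨C, (h𝒟e hC).1, C, hC, subset_rfl⟩ ⟨E, (hℰe hE).1, (hℰe hE).1, hES⟩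
  exact hZ.2 hZS

/-! ### The ends cover the space -/

/-- The union of all ends together with a closed connected set `D` is connected if every end off `D`
misses a fat continuum. -/
theorem isPreconnected_union_biUnion_ends [TopologicalSpace X] [SecondCountableTopology X]
    [T2Space X] [CompactSpace X] [PreconnectedSpace X]
    (h : HasPropertyOfKelley X) (hNB : IsContinuum (nonblockers X)) {D : Set X} (hD : IsClosed D)
    (hDc : IsPreconnected D) (hmeet : D.Nonempty → (D ∩ ⋃ C ∈ ends X, (C : Set X)).Nonempty)
    (hfat : ∀ C ∈ ends X, (C : Set X) ⊆ Dᶜ → MissesFat C) :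
    IsPreconnected (D ∪ ⋃ C ∈ ends X, (C : Set X)) := by
  have hends := isClosed_ends h hNB.1.isClosed
  have hY : IsClosed (⋃ C ∈ ends X, (C : Set X)) :=
    (NonemptyCompacts.isCompact_biUnion_coe_of_isCompact hends.isCompact).isClosed
  have hDuv : ∀ u v, IsClosed u → IsClosed v → D ∪ (⋃ C ∈ ends X, (C : Set X)) ⊆ u ∪ v →
      Disjoint u v → D ⊆ u → D ∪ (⋃ C ∈ ends X, (C : Set X)) ⊆ u ∨
        D ∪ (⋃ C ∈ ends X, (C : Set X)) ⊆ v := by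
    intro u v hu hv huv hdisj hDu
    by_contra! hcon
    have hside : ∀ C ∈ ends X, (C : Set X) ⊆ u ∨ (C : Set X) ⊆ v := fun C hC =>
      isPreconnected_iff_subset_of_disjoint_closed.1 (isContinuum_of_mem_ends hC).2.2 u v hu hv
        (((subset_biUnion_of_mem hC).trans subset_union_right).trans huv)
        (by rw [hdisj.inter_eq, inter_empty])
    refine false_of_ends_split h hNB (𝒟 := {C | C ∈ ends X ∧ (C : Set X) ⊆ v})
      (ℰ := {C | C ∈ ends X ∧ (C : Set X) ⊆ u})
      (hends.inter (NonemptyCompacts.isClosed_subsets_of_isClosed hv))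
      (hends.inter (NonemptyCompacts.isClosed_subsets_of_isClosed hu)) ?_ ?_ ?_ ?_ ?_
    · ext C
      constructor
      · rintro (hC | hC) <;> exact hC.1
      · exact fun hC => (hside C hC).symm.imp (fun hCv => ⟨hC, hCv⟩) fun hCu => ⟨hC, hCu⟩
    · rw [disjoint_left]
      rintro C ⟨-, hCv⟩ ⟨-, hCu⟩
      obtain ⟨x, hx⟩ := C.nonempty
      exact hdisj.le_bot ⟨hCu hx, hCv hx⟩
    · obtain ⟨y, hy, hyu⟩ := not_subset.1 hcon.1
      obtain ⟨C, hC, hyC⟩ := mem_iUnion₂.1 (hy.resolve_left fun hyD => hyu (hDu hyD))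
      exact ⟨C, hC, (hside C hC).resolve_left fun hCu => hyu (hCu hyC)⟩
    · obtain rfl | hDne := D.eq_empty_or_nonempty
      · obtain ⟨y, hy, hyv⟩ := not_subset.1 hcon.2
        obtain ⟨C, hC, hyC⟩ := mem_iUnion₂.1 (hy.resolve_left (notMem_empty y))
        exact ⟨C, hC, (hside C hC).resolve_right fun hCv => hyv (hCv hyC)⟩
      · obtain ⟨y, hyD, hy⟩ := hmeet hDne
        obtain ⟨C, hC, hyC⟩ := mem_iUnion₂.1 hy
        exact ⟨C, hC, (hside C hC).resolve_right fun hCv => hdisj.le_bot ⟨hDu hyD, hCv hyC⟩⟩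
    · rintro C ⟨hC, hCv⟩
      exact hfat C hC fun x hxC hxD => hdisj.le_bot ⟨hDu hxD, hCv hxC⟩
  rw [isPreconnected_iff_subset_of_fully_disjoint_closed (hD.union hY)]
  intro u v hu hv huv hdisj
  obtain hDu | hDv := isPreconnected_iff_subset_of_disjoint_closed.1 hDc u v hu hv
    (subset_union_left.trans huv) (by rw [hdisj.inter_eq, inter_empty])
  · exact hDuv u v hu hv huv hdisj hDu
  · exact (hDuv v u hv hu (by rwa [union_comm v u]) hdisj.symm hDv).symm

/-- An end that misses no fat continuum is contained in all of them. -/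
theorem subset_of_not_missesFat [TopologicalSpace X] {B : NonemptyCompacts X}
    (hB : B ∈ ends X) (hBf : ¬ MissesFat B) {W : Set X} (hW : IsContinuum W)
    (hWi : (interior W).Nonempty) : (B : Set X) ⊆ W := by
  have hmeet : (W ∩ B).Nonempty := by
    by_contra hcon
    exact hBf ⟨W, hW, hWi, fun w hw hwB => hcon ⟨w, hw, hwB⟩⟩
  exact (hB.2 W hW hmeet).resolve_left (not_subset_of_mem_nonblockers hB.1 hWi)

/-- If some end lies in all fat continua, then finitely many ends off a fat continuum `W` always
lie in a common nonblocker. Indeed, if `κ_{X∖S}(W)` were not dense for the union `S` of these ends,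
then one of the finitely many components that meet `S` of the complement of `κ_{X∖S}(W)` would have
interior, hence would be a fat continuum disjoint from `W`. -/
theorem exists_nonblocker_of_finite_ends [TopologicalSpace X] [FirstCountableTopology X]
    [T2Space X] [CompactSpace X] [PreconnectedSpace X]
    (h : HasPropertyOfKelley X) {B : NonemptyCompacts X} (hB : B ∈ ends X) (hBf : ¬ MissesFat B)
    {W : Set X} (hW : IsContinuum W) (hWi : (interior W).Nonempty)
    {s : Set (NonemptyCompacts X)} (hs : s.Finite) (hse : s ⊆ ends X)
    (hsW : ∀ T ∈ s, (T : Set X) ⊆ Wᶜ) :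
    ∃ A ∈ nonblockers X, ∀ T ∈ s, (T : Set X) ⊆ A := by
  obtain rfl | ⟨T₀, hT₀⟩ := s.eq_empty_or_nonempty
  · exact ⟨B, hB.1, fun T hT => absurd hT (notMem_empty T)⟩
  set S : Set X := ⋃ T ∈ s, (T : Set X) with hS
  have hScl : IsClosed S := hs.isClosed_biUnion fun T _ => T.isCompact.isClosed
  have hSne : S.Nonempty := T₀.nonempty.mono (subset_biUnion_of_mem hT₀)
  have hWS : W ⊆ Sᶜ := by
    intro w hw hwS
    obtain ⟨T, hT, hwT⟩ := mem_iUnion₂.1 hwS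
    exact hsW T hT hwT hw
  have hr := isReach_kappa h hScl hSne hW hWi hWS
  set V : Set X := kappa S W with hV
  have hSV : S ⊆ Vᶜ := fun x hx hxV => kappa_subset_compl S W hxV hx
  have hd : Dense V := by
    rw [dense_iff_closure_eq]
    by_contra hne
    have hVu : Vᶜ ≠ univ := by
      obtain ⟨w, hw⟩ := hW.2.nonempty
      exact fun hu => (hu ▸ mem_univ w : w ∈ Vᶜ) (hr.2.2.1 hw)
    let E : NonemptyCompacts X → Set X := fun T => connectedComponentIn Vᶜ T.nonempty.some
    have hcover : (closure V)ᶜ ⊆ ⋃ T ∈ s, E T := by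
      intro z hz
      have hzV : z ∈ Vᶜ := fun hzV => hz (subset_closure hzV)
      have hK := isContinuum_connectedComponentIn hr.1.isClosed_compl hzV
      obtain ⟨b, hbK, hb⟩ := not_subset.1
        (not_connectedComponentIn_subset_interior hr.1.isClosed_compl hVu hzV)
      rw [interior_compl, notMem_compl_iff] at hb
      have hmeet : (connectedComponentIn Vᶜ z ∩ S).Nonempty := by
        by_contra hcon
        obtain ⟨N, hN, hNo, hbN⟩ := eventually_nhds_iff.1 (h.eventually hK hbK hScl.isOpen_compl
          (fun x hx hxS => hcon ⟨x, hx, hxS⟩) isClosed_closure.isOpen_compl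
          ⟨z, mem_connectedComponentIn hzV, hz⟩)
        obtain ⟨v, hvN, hvV⟩ := mem_closure_iff.1 hb N hNo hbN
        obtain ⟨L, hL, hvL, hLS, y, hyL, hy⟩ := hN v hvN
        obtain ⟨M, hM, hWM, hMS, hvM⟩ := mem_kappa.1 hvV
        refine hy (subset_closure (mem_kappa.2 ⟨M ∪ L, hM.union hL ⟨v, hvM, hvL⟩,
          hWM.mono (inter_subset_inter_right _ subset_union_left), union_subset hMS hLS,
          Or.inr hyL⟩))
      obtain ⟨q, hqK, hqS⟩ := hmeet
      obtain ⟨T, hT, hqT⟩ := mem_iUnion₂.1 hqS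
      refine mem_iUnion₂.2 ⟨T, hT, ?_⟩
      have hTq : (T : Set X) ⊆ connectedComponentIn Vᶜ q :=
        (isContinuum_of_mem_ends (hse hT)).2.2.subset_connectedComponentIn hqT
          ((subset_biUnion_of_mem hT).trans hSV)
      change z ∈ connectedComponentIn Vᶜ T.nonempty.some
      rw [← connectedComponentIn_eq (hTq T.nonempty.some_mem), ← connectedComponentIn_eq hqK]
      exact mem_connectedComponentIn hzV
    have hEcont : ∀ T ∈ s, IsContinuum (E T) := fun T hT =>
      isContinuum_connectedComponentIn hr.1.isClosed_compl
        (hSV (subset_biUnion_of_mem hT T.nonempty.some_mem))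
    obtain ⟨T, hT, hTi⟩ : ∃ T ∈ s, (interior (E T)).Nonempty := by
      by_contra! hcon
      obtain ⟨z, hzV, hz⟩ := (dense_biInter_of_isOpen
        (fun T hT => (hEcont T hT).1.isClosed.isOpen_compl) hs.countable
        (fun T hT => interior_eq_empty_iff_dense_compl.1 (hcon T hT))).inter_open_nonempty _
        isClosed_closure.isOpen_compl (nonempty_compl.2 hne)
      obtain ⟨T, hT, hzT⟩ := mem_iUnion₂.1 (hcover hzV)
      exact mem_iInter₂.1 hz T hT hzT
    obtain ⟨b, hb⟩ := B.nonempty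
    exact connectedComponentIn_subset _ _
      (subset_of_not_missesFat hB hBf (hEcont T hT) hTi hb)
      (hr.2.2.1 (subset_of_not_missesFat hB hBf hW hWi hb))
  obtain ⟨A, hA, hAV⟩ := hr.exists_nonblocker hW hd
  exact ⟨A, hA, fun T hT => hAV ▸ (subset_biUnion_of_mem hT).trans hSV⟩

/-- If the ends cover the complement of a proper fat continuum `P`, then every end misses some fat
continuum. Otherwise each finite subset of `X∖P` lies in a nonblocker, hence so does `X∖P`, by
compactness of the space of nonblockers. -/
theorem missesFat_of_mem_ends [TopologicalSpace X] [FirstCountableTopology X]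
    [T2Space X] [CompactSpace X] [PreconnectedSpace X]
    (h : HasPropertyOfKelley X) (hNB : IsContinuum (nonblockers X)) {P : Set X}
    (hP : IsContinuum P) (hPi : (interior P).Nonempty) (hPu : P ≠ univ)
    (hPY : Pᶜ ⊆ ⋃ C ∈ ends X, (C : Set X)) {B : NonemptyCompacts X} (hB : B ∈ ends X) :
    MissesFat B := by
  by_contra hBf
  have hex : ∀ x : (Pᶜ : Set X), ∃ T ∈ ends X, (x : X) ∈ T ∧ (T : Set X) ⊆ Pᶜ := by
    rintro ⟨x, hx⟩
    obtain ⟨T, hT, hxT⟩ := mem_iUnion₂.1 (hPY hx)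
    refine ⟨T, hT, hxT, fun y hyT hyP => ?_⟩
    obtain hle | hle := hT.2 P hP ⟨y, hyP, hyT⟩
    · exact not_subset_of_mem_nonblockers hT.1 hPi hle
    · exact hx (hle hxT)
  choose T hT hxT hTP using hex
  obtain ⟨A, hA, hAP⟩ := hNB.1.inter_iInter_nonempty
    (fun x : (Pᶜ : Set X) => {A : NonemptyCompacts X | ((A : Set X) ∩ {(x : X)}).Nonempty})
    (fun x => NonemptyCompacts.isClosed_inter_nonempty_of_isClosed isClosed_singleton)
    (fun u => by
      obtain ⟨A, hA, hTA⟩ := exists_nonblocker_of_finite_ends h hB hBf hP hPi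
        (u.finite_toSet.image T) (by rintro _ ⟨x, -, rfl⟩; exact hT x)
        (by rintro _ ⟨x, -, rfl⟩; exact hTP x)
      exact ⟨A, hA, mem_iInter₂.2 fun x hx =>
        ⟨x, hTA (T x) (mem_image_of_mem T hx) (hxT x), rfl⟩⟩)
  refine not_subset_of_mem_nonblockers hA (O := Pᶜ) ?_ fun x hx => ?_
  · rw [hP.1.isClosed.isOpen_compl.interior_eq]
    exact nonempty_compl.2 hPu
  · obtain ⟨y, hyA, rfl⟩ := mem_iInter.1 hAP ⟨x, hx⟩
    exact hyA

/-- The ends cover `X`. -/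
theorem biUnion_ends_eq_univ [TopologicalSpace X] [SecondCountableTopology X]
    [T2Space X] [CompactSpace X] [PreconnectedSpace X] (hdec : IsDecomposable X)
    (h : HasPropertyOfKelley X) (hNB : IsContinuum (nonblockers X)) :
    (⋃ C ∈ ends X, (C : Set X)) = univ := by
  obtain ⟨P, hP, Q, hQ, hPu, hQu, hPQ⟩ := hdec
  have hint : ∀ {P Q : NonemptyCompacts X}, (Q : Set X) ≠ univ → (P : Set X) ∪ Q = univ →
      (interior (P : Set X)).Nonempty := fun {P Q} hQu hPQ =>
    (nonempty_compl.2 hQu).mono (interior_maximal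
      (fun x hx => (hPQ ▸ mem_univ x : x ∈ (P : Set X) ∪ Q).resolve_right hx)
      Q.isCompact.isClosed.isOpen_compl)
  have hPi := hint hQu hPQ
  have hQi := hint hPu (by rwa [union_comm])
  have hends := isClosed_ends h hNB.1.isClosed
  set Y : Set X := ⋃ C ∈ ends X, (C : Set X) with hY
  have hYc : IsCompact Y := NonemptyCompacts.isCompact_biUnion_coe_of_isCompact hends.isCompact
  -- A proper fat continuum cannot contain all ends.
  have hfull : ∀ Z : Set X, Y ⊆ Z → IsContinuum Z → (interior Z).Nonempty → Z = univ := by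
    intro Z hYZ hZ hZi
    by_contra hZu
    obtain ⟨T, hT, hTZ⟩ := exists_end_subset_compl h hZ hZi hZu
    obtain ⟨t, ht⟩ := T.nonempty
    exact hTZ ht (hYZ (mem_biUnion hT ht))
  have hPYne : ((P : Set X) ∩ Y).Nonempty := by
    obtain ⟨T, hT, hTQ⟩ := exists_end_subset_compl h hQ hQi hQu
    obtain ⟨t, ht⟩ := T.nonempty
    exact ⟨t, (hPQ ▸ mem_univ t : t ∈ (P : Set X) ∪ Q).resolve_right (hTQ ht), mem_biUnion hT ht⟩
  have hPY : (P : Set X) ∪ Y = univ := by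
    refine hfull _ subset_union_right ⟨P.isCompact.union hYc, P.nonempty.mono subset_union_left,
      ?_⟩ (hPi.mono (interior_mono subset_union_left))
    exact isPreconnected_union_biUnion_ends h hNB P.isCompact.isClosed hP.2.2 (fun _ => hPYne)
      fun C _ hCP => ⟨P, hP, hPi, subset_compl_comm.1 hCP⟩
  have hPcY : (P : Set X)ᶜ ⊆ Y := fun x hx =>
    (hPY ▸ mem_univ x : x ∈ (P : Set X) ∪ Y).resolve_left hx
  have hYconn : IsPreconnected (∅ ∪ Y) :=
    isPreconnected_union_biUnion_ends h hNB isClosed_empty isPreconnected_empty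
      (fun hne => absurd hne not_nonempty_empty)
      fun C hC _ => missesFat_of_mem_ends h hNB hP hPi hPu hPcY hC
  rw [empty_union] at hYconn
  exact hfull Y subset_rfl ⟨hYc, hPYne.mono inter_subset_right, hYconn⟩
    ((nonempty_compl.2 hPu).mono (interior_maximal hPcY P.isCompact.isClosed.isOpen_compl))

/-! ### The decomposition into ends -/

/-- The minimal nonblocker through a point of an end is that end. -/
theorem minimalNonblocker_eq_of_mem_end [TopologicalSpace X] [T2Space X] [CompactSpace X]
    {C : NonemptyCompacts X} (hC : C ∈ ends X) {x : X} (hx : x ∈ C) :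
    minimalNonblocker x = C := by
  refine NonemptyCompacts.ext (subset_antisymm ?_ ?_)
  · intro y hy
    exact mem_iInter₂.1 hy C ⟨hC.1, hx⟩
  · exact subset_iInter₂ fun A hA => end_subset_nonblocker hC hA.1 ⟨x, hx, hA.2⟩

theorem mem_minimalNonblocker [TopologicalSpace X] [T2Space X] [CompactSpace X] (x : X) :
    x ∈ minimalNonblocker x :=
  mem_iInter₂.2 fun _ hA => hA.2

theorem minimalNonblocker_subset [TopologicalSpace X] [T2Space X] [CompactSpace X]
    {A : NonemptyCompacts X} (hA : A ∈ nonblockers X) {x : X} (hx : x ∈ A) :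
    (minimalNonblocker x : Set X) ⊆ A := fun _ hy =>
  mem_iInter₂.1 hy A ⟨hA, hx⟩

theorem minimalNonblocker_mem_ends [TopologicalSpace X] [T2Space X] [CompactSpace X]
    (hcov : (⋃ C ∈ ends X, (C : Set X)) = univ) (x : X) : minimalNonblocker x ∈ ends X := by
  obtain ⟨C, hC, hx⟩ := mem_iUnion₂.1 (hcov ▸ mem_univ x)
  rwa [minimalNonblocker_eq_of_mem_end hC hx]

theorem minimalNonblocker_eq_of_mem [TopologicalSpace X] [T2Space X] [CompactSpace X]
    (hcov : (⋃ C ∈ ends X, (C : Set X)) = univ) {x y : X} (h : y ∈ minimalNonblocker x) :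
    minimalNonblocker y = minimalNonblocker x :=
  minimalNonblocker_eq_of_mem_end (minimalNonblocker_mem_ends hcov x) h

/-- If the ends are a closed family covering `X`, then `π` is continuous: the preimage of a closed
set is the union of a compact family of compact sets. -/
theorem continuous_minimalNonblocker [TopologicalSpace X] [T2Space X] [CompactSpace X]
    (hcov : (⋃ C ∈ ends X, (C : Set X)) = univ) (hends : IsClosed (ends X)) :
    Continuous (minimalNonblocker (X := X)) := by
  rw [continuous_iff_isClosed]
  intro F hF
  have heq : minimalNonblocker ⁻¹' F = ⋃ C ∈ ends X ∩ F, (C : Set X) := by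
    ext x
    constructor
    · exact fun hx => mem_biUnion ⟨minimalNonblocker_mem_ends hcov x, hx⟩ (mem_minimalNonblocker x)
    · intro hx
      obtain ⟨C, ⟨hC, hCF⟩, hxC⟩ := mem_iUnion₂.1 hx
      rwa [mem_preimage, minimalNonblocker_eq_of_mem_end hC hxC]
  rw [heq]
  exact (NonemptyCompacts.isCompact_biUnion_coe_of_isCompact
    (hends.inter hF).isCompact).isClosed

theorem isContinuousDecomposition_piDecomposition [TopologicalSpace X] [T2Space X]
    [CompactSpace X] (hcov : (⋃ C ∈ ends X, (C : Set X)) = univ)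
    (hπ : Continuous (minimalNonblocker (X := X))) :
    IsContinuousDecomposition
      ((fun A : NonemptyCompacts X => (A : Set X)) '' piDecomposition X) := by
  refine ⟨⟨?_, fun x => ⟨minimalNonblocker x,
    ⟨⟨_, ⟨x, rfl⟩, rfl⟩, mem_minimalNonblocker x⟩, ?_⟩⟩, ?_, ?_⟩
  · rintro ⟨A, -, hA⟩
    exact A.nonempty.ne_empty hA
  · rintro _ ⟨⟨_, ⟨y, rfl⟩, rfl⟩, hxy⟩
    exact congrArg _ (minimalNonblocker_eq_of_mem hcov hxy).symm
  · rintro _ ⟨_, ⟨x, rfl⟩, rfl⟩ U hU hxU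
    refine ⟨_, (NonemptyCompacts.isOpen_subsets_of_isOpen hU).preimage hπ, fun y hy => ?_, ?_⟩
    · rw [mem_preimage, minimalNonblocker_eq_of_mem hcov hy]
      exact hxU
    · rintro _ ⟨_, ⟨z, rfl⟩, rfl⟩ ⟨y, hyz, hy⟩
      rw [mem_preimage, minimalNonblocker_eq_of_mem hcov hyz] at hy
      exact hy
  · rintro _ ⟨_, ⟨w, rfl⟩, rfl⟩ x hx y hy U hU hxU
    refine ⟨_, (NonemptyCompacts.isOpen_inter_nonempty_of_isOpen hU).preimage hπ, ?_, ?_⟩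
    · rw [mem_preimage, minimalNonblocker_eq_of_mem hcov hy]
      exact ⟨x, hx, hxU⟩
    · rintro _ ⟨_, ⟨z, rfl⟩, rfl⟩ ⟨y, hyz, hy⟩
      rw [mem_preimage, minimalNonblocker_eq_of_mem hcov hyz] at hy
      exact hy

theorem quotientMap_surjective [TopologicalSpace X] [T2Space X] [CompactSpace X] :
    Function.Surjective (quotientMap X) := by
  rintro ⟨_, x, rfl⟩
  exact ⟨x, rfl⟩

theorem continuous_quotientMap [TopologicalSpace X] [T2Space X] [CompactSpace X]
    (hπ : Continuous (minimalNonblocker (X := X))) : Continuous (quotientMap X) :=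
  hπ.subtype_mk _

theorem isQuotientMap_quotientMap [TopologicalSpace X] [T2Space X] [CompactSpace X]
    (hπ : Continuous (minimalNonblocker (X := X))) : IsQuotientMap (quotientMap X) :=
  (continuous_quotientMap hπ).isClosedMap.isQuotientMap (continuous_quotientMap hπ)
    quotientMap_surjective

/-- `q` is open: the saturation of an open set `U` consists of the `x` for which `π(x)` meets
`U`. -/
theorem isOpenMap_quotientMap [TopologicalSpace X] [T2Space X] [CompactSpace X]
    (hcov : (⋃ C ∈ ends X, (C : Set X)) = univ)
    (hπ : Continuous (minimalNonblocker (X := X))) : IsOpenMap (quotientMap X) := by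
  intro U hU
  rw [← (isQuotientMap_quotientMap hπ).isOpen_preimage]
  convert! (NonemptyCompacts.isOpen_inter_nonempty_of_isOpen hU).preimage hπ using 1
  ext x
  constructor
  · rintro ⟨y, hyU, hyx⟩
    have hyx : minimalNonblocker y = minimalNonblocker x := congrArg Subtype.val hyx
    exact ⟨y, by rw [← hyx]; exact mem_minimalNonblocker y, hyU⟩
  · rintro ⟨y, hyx, hyU⟩
    exact ⟨y, hyU, Subtype.ext (minimalNonblocker_eq_of_mem hcov hyx)⟩

/-- Nonblockers are unions of ends. -/
theorem quotientMap_preimage_image [TopologicalSpace X] [T2Space X] [CompactSpace X]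
    {A : NonemptyCompacts X} (hA : A ∈ nonblockers X) :
    quotientMap X ⁻¹' (quotientMap X '' A) = A := by
  refine subset_antisymm ?_ (subset_preimage_image _ _)
  rintro x ⟨y, hyA, hyx⟩
  have hyx : minimalNonblocker y = minimalNonblocker x := congrArg Subtype.val hyx
  exact minimalNonblocker_subset hA hyA (hyx ▸ mem_minimalNonblocker x)

/-! ### Nonblockers of the decomposition space -/

theorem IsContinuum.image {Y : Type*} [TopologicalSpace X] [TopologicalSpace Y] {S : Set X}
    (hS : IsContinuum S) {f : X → Y} (hf : Continuous f) : IsContinuum (f '' S) :=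
  ⟨hS.1.image hf, hS.2.image f hf.continuousOn⟩

theorem map_quotientMap_mem_nonblockers [TopologicalSpace X] [T2Space X] [CompactSpace X]
    (hπ : Continuous (minimalNonblocker (X := X))) {A : NonemptyCompacts X}
    (hA : A ∈ nonblockers X) :
    A.map (quotientMap X) (continuous_quotientMap hπ) ∈ nonblockers (piDecomposition X) := by
  have hq := continuous_quotientMap hπ
  refine ⟨fun hu => hA.1 ?_, fun μ hμ => ?_⟩
  · rw [NonemptyCompacts.coe_map] at hu
    rw [← quotientMap_preimage_image hA, hu, preimage_univ]
  · obtain ⟨x, rfl⟩ := quotientMap_surjective μ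
    have hxA : x ∉ A := fun hxA => hμ (mem_image_of_mem _ hxA)
    refine (quotientMap_surjective.denseRange.dense_image hq (hA.2 x hxA)).mono ?_
    rintro _ ⟨y, hy, rfl⟩
    obtain ⟨L, hL, ⟨z, rfl, hzL⟩, hLA, hyL⟩ := mem_kappa.1 hy
    refine mem_kappa.2 ⟨_, hL.image hq, ⟨_, rfl, mem_image_of_mem _ hzL⟩, ?_,
      mem_image_of_mem _ hyL⟩
    rintro _ ⟨w, hw, rfl⟩ hwA
    exact hLA hw ((quotientMap_preimage_image hA).subset hwA)

/-- The preimage under `q` of a continuum is a continuum, since the fibres of `q` are ends, hence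
connected. -/
theorem IsContinuum.preimage_quotientMap [TopologicalSpace X] [T2Space X] [CompactSpace X]
    [PreconnectedSpace X] (hcov : (⋃ C ∈ ends X, (C : Set X)) = univ)
    (hπ : Continuous (minimalNonblocker (X := X))) {L : Set (piDecomposition X)}
    (hL : IsContinuum L) : IsContinuum (quotientMap X ⁻¹' L) := by
  refine ⟨(hL.1.isClosed.preimage (continuous_quotientMap hπ)).isCompact,
    hL.2.nonempty.preimage quotientMap_surjective, ?_⟩
  have heq : quotientMap X ⁻¹' L = ⋃ μ ∈ L, ((μ : NonemptyCompacts X) : Set X) := by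
    ext x
    constructor
    · exact fun hx => mem_biUnion (x := quotientMap X x) hx (mem_minimalNonblocker x)
    · intro hx
      obtain ⟨⟨_, y, rfl⟩, hyL, hxy⟩ := mem_iUnion₂.1 hx
      have : quotientMap X x = ⟨minimalNonblocker y, y, rfl⟩ :=
        Subtype.ext (minimalNonblocker_eq_of_mem hcov hxy)
      rwa [mem_preimage, this]
  rw [heq]
  let _ : TopologicalSpace (Set X) := .vietoris X
  refine vietoris.isPreconnected_biUnion hL.2.2
    (NonemptyCompacts.continuous_coe.comp continuous_subtype_val).continuousOn ?_
  obtain ⟨⟨_, y, rfl⟩, hy⟩ := hL.2.nonempty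
  exact ⟨_, hy, (isContinuum_of_mem_ends (minimalNonblocker_mem_ends hcov y)).2.2⟩

/-- The preimage under `q` of a nonempty compact subset of the decomposition space. -/
def comapQuotientMap [TopologicalSpace X] [T2Space X] [CompactSpace X]
    (hπ : Continuous (minimalNonblocker (X := X))) (B : NonemptyCompacts (piDecomposition X)) :
    NonemptyCompacts X :=
  ⟨⟨quotientMap X ⁻¹' B,
    (B.isCompact.isClosed.preimage (continuous_quotientMap hπ)).isCompact⟩,
    B.nonempty.preimage quotientMap_surjective⟩

theorem comapQuotientMap_mem_nonblockers [TopologicalSpace X] [T2Space X] [CompactSpace X]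
    [PreconnectedSpace X] (hcov : (⋃ C ∈ ends X, (C : Set X)) = univ)
    (hπ : Continuous (minimalNonblocker (X := X))) {B : NonemptyCompacts (piDecomposition X)}
    (hB : B ∈ nonblockers (piDecomposition X)) : comapQuotientMap hπ B ∈ nonblockers X := by
  refine ⟨fun hu => hB.1 ?_, fun x hx => ?_⟩
  · change quotientMap X ⁻¹' B = univ at hu
    rw [← image_preimage_eq (B : Set (piDecomposition X)) quotientMap_surjective, hu,
      image_univ, quotientMap_surjective.range_eq]
  · refine ((hB.2 (quotientMap X x) hx).preimage (isOpenMap_quotientMap hcov hπ)).mono ?_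
    intro y hy
    obtain ⟨L, hL, ⟨z, rfl, hzL⟩, hLB, hyL⟩ := mem_kappa.1 hy
    exact mem_kappa.2 ⟨_, hL.preimage_quotientMap hcov hπ, ⟨x, rfl, hzL⟩,
      fun w hw hwB => hLB hw hwB, hyL⟩

/-- `A ↦ q(A)` as a homeomorphism between the spaces of nonblockers, with inverse
`B ↦ q⁻¹(B)`. -/
theorem nonempty_nonblockers_homeomorph [TopologicalSpace X] [T2Space X] [CompactSpace X]
    [PreconnectedSpace X] (hcov : (⋃ C ∈ ends X, (C : Set X)) = univ)
    (hπ : Continuous (minimalNonblocker (X := X))) (hNB : IsCompact (nonblockers X)) :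
    Nonempty (nonblockers X ≃ₜ nonblockers (piDecomposition X)) := by
  have : CompactSpace (nonblockers X) := isCompact_iff_compactSpace.1 hNB
  let e : nonblockers X ≃ nonblockers (piDecomposition X) :=
    { toFun := fun A => ⟨_, map_quotientMap_mem_nonblockers hπ A.2⟩
      invFun := fun B => ⟨_, comapQuotientMap_mem_nonblockers hcov hπ B.2⟩
      left_inv := fun A => Subtype.ext (NonemptyCompacts.ext (quotientMap_preimage_image A.2))
      right_inv := fun B => Subtype.ext (NonemptyCompacts.ext
        (image_preimage_eq _ quotientMap_surjective)) }
  have he : Continuous e :=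
    ((continuous_quotientMap hπ).nonemptyCompacts_map.comp continuous_subtype_val).subtype_mk _
  exact ⟨he.homeoOfEquivCompactToT2⟩

/-- One-point subsets of the decomposition space are images of ends. -/
theorem singletons_subset_nonblockers [TopologicalSpace X] [T2Space X] [CompactSpace X]
    (hcov : (⋃ C ∈ ends X, (C : Set X)) = univ)
    (hπ : Continuous (minimalNonblocker (X := X))) :
    singletons (piDecomposition X) ⊆ nonblockers (piDecomposition X) := by
  rintro _ ⟨μ, rfl⟩
  obtain ⟨x, rfl⟩ := quotientMap_surjective μ
  convert! map_quotientMap_mem_nonblockers hπ (minimalNonblocker_mem_ends hcov x).1 using 1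
  refine NonemptyCompacts.ext ?_
  rw [NonemptyCompacts.coe_map]
  change {quotientMap X x} = _
  refine subset_antisymm (singleton_subset_iff.2 (mem_image_of_mem _ (mem_minimalNonblocker x))) ?_
  rintro _ ⟨y, hy, rfl⟩
  exact Subtype.ext (minimalNonblocker_eq_of_mem hcov hy)

end Nonblock

theorem mainTheorem7 {X : Type*} [MetricSpace X] [CompactSpace X] [ConnectedSpace X]
    (hdec : Nonblock.IsDecomposable X)
    (hKelley : Nonblock.HasPropertyOfKelley X)
    (hNB : Nonblock.IsContinuum (Nonblock.nonblockers X)) :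
    -- `𝒩 = {π(x) : x ∈ X}` is a continuous decomposition of `X` and a continuum,
    -- and its topology is the decomposition (quotient) topology given by `q`
    (Nonblock.IsContinuousDecomposition
        ((fun A : TopologicalSpace.NonemptyCompacts X => (A : Set X)) ''
          Nonblock.piDecomposition X) ∧
      Nonblock.IsContinuum (Nonblock.piDecomposition X) ∧
      Topology.IsQuotientMap (Nonblock.quotientMap X)) ∧
    -- `NB(F₁(X))` is homeomorphic to `NB(F₁(𝒩))`
    Nonempty (Nonblock.nonblockers X ≃ₜ Nonblock.nonblockers (Nonblock.piDecomposition X)) ∧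
    -- `F₁(𝒩) ⊆ NB(F₁(𝒩))`
    Nonblock.singletons (Nonblock.piDecomposition X) ⊆
      Nonblock.nonblockers (Nonblock.piDecomposition X) := by
  have hcov := Nonblock.biUnion_ends_eq_univ hdec hKelley hNB
  have hπ := Nonblock.continuous_minimalNonblocker hcov
    (Nonblock.isClosed_ends hKelley hNB.1.isClosed)
  exact ⟨⟨Nonblock.isContinuousDecomposition_piDecomposition hcov hπ,
    ⟨isCompact_range hπ, isConnected_range hπ⟩, Nonblock.isQuotientMap_quotientMap hπ⟩,
    Nonblock.nonempty_nonblockers_homeomorph hcov hπ hNB.1,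
    Nonblock.singletons_subset_nonblockers hcov hπ⟩
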